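/- Let $K\ge 1$ and let $N_0,N_1,\dots,N_K$ be positive integers with $N_0=\min_{0\le k\le K}N_k$. Let $Q_1,\dots,Q_K$ be random matrices, $Q_k$ of size $N_k\times N_{k-1}$, such that all entries of all these matrices are independent circularly symmetric complex Gaussian variables with zero mean and unit variance (density $\pi^{-1}e^{-|z|^2}$ on $\mathbb{C}$). Put $H=Q_KQ_{K-1}\cdots Q_1$, and for $q>0$ let $$\tilde R(q)=\mathbb{E}\bigl[\ln\det(I+qH^\dagger H)\bigr]$$ be the ergodic capacity of the Rayleigh product channel with signal-to-noise ratio $q$. Let $\gamma$ be the Euler–Mascheroni constant and $$g=\frac1{N_0}\sum_{k=1}^{K}\sum_{\ell=1}^{N_0}\sum_{r=1}^{N_k-\ell}\frac1r .$$ Then $\tilde R(q)$ is finite, and the lower bound $$N_0\ln\bigl(1+q\,e^{g-K\gamma}\bigr)\le\tilde R(q)\qquad(q>0)$$ holds and is asymptotically tight as $q\to\infty$: $$\lim_{q\to\infty}\Bigl(\tilde R(q)-N_0\ln\bigl(1+q\,e^{g-K\gamma}\bigr)\Bigr)=0 .$$ Moreover $\det(H^\dagger H)>0$ almost surely, $\ln\det(H^\dagger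 H)$ is integrable, and $$\lim_{q\to\infty}\bigl(\tilde R(q)-N_0\ln q\bigr)=\mathbb{E}\bigl[\ln\det(H^\dagger H)\bigr]=N_0(g-K\gamma).$$ -/

import Mathlib

open MeasureTheory ProbabilityTheory Filter Topology
open scoped Matrix

/-- The circularly symmetric complex Gaussian law with zero mean and unit variance: density
`exp (-|z|²) / π` with respect to Lebesgue measure on `ℂ`. -/
noncomputable def stdComplexGaussian : Measure ℂ :=
  volume.withDensity (fun z : ℂ => ENNReal.ofReal (Real.exp (-‖z‖ ^ 2) / Real.pi))

/-- `Q 0, …, Q (K - 1)` are the channel matrices `Q_1, …, Q_K` of the `K` tiers (so `Q k` is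
`Q_{k+1}`, of size `N_{k+1} × N_k`): all entries of all of these matrices are independent, with
the standard complex Gaussian law. The values `Q k` with `k ≥ K` play no role. -/
structure IsRayleighChain {Ω : Type*} [MeasurableSpace Ω] (P : Measure Ω) (K : ℕ) (N : ℕ → ℕ)
    (Q : (k : ℕ) → Ω → Matrix (Fin (N (k + 1))) (Fin (N k)) ℂ) : Prop where
  /-- each entry is standard complex Gaussian -/
  law : ∀ k < K, ∀ (i : Fin (N (k + 1))) (j : Fin (N k)),
    HasLaw (fun ω => Q k ω i j) stdComplexGaussian P
  /-- the entries are jointly independent -/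
  indep : iIndepFun
    (fun (e : Σ k : Fin K, Fin (N ((k : ℕ) + 1)) × Fin (N (k : ℕ))) (ω : Ω) =>
      Q (e.1 : ℕ) ω e.2.1 e.2.2) P

/-- The product channel `H = Q_K ⋯ Q_2 Q_1`, of size `N_K × N_0`. -/
noncomputable def productChannel {Ω : Type*} (N : ℕ → ℕ)
    (Q : (k : ℕ) → Ω → Matrix (Fin (N (k + 1))) (Fin (N k)) ℂ) :
    (K : ℕ) → Ω → Matrix (Fin (N K)) (Fin (N 0)) ℂ
  | 0, _ => 1
  | K + 1, ω => Q K ω * productChannel N Q K ω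

/-- `ln det A`, used for Hermitian `A`, whose determinant is real. -/
noncomputable def lnDet {n : ℕ} (A : Matrix (Fin n) (Fin n) ℂ) : ℝ :=
  Real.log A.det.re

/-- The capacity `ln det (I + q H† H)`, in nats per channel use. -/
noncomputable def capacity {m n : ℕ} (H : Matrix (Fin m) (Fin n) ℂ) (q : ℝ) : ℝ :=
  lnDet (1 + (q : ℂ) • (Hᴴ * H))

/-- The ergodic capacity `E [ln det (I + q H† H)]` of a random channel matrix `H`. -/
noncomputable def ergodicCapacity {Ω : Type*} [MeasurableSpace Ω] (P : Measure Ω) {m n : ℕ}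
    (H : Ω → Matrix (Fin m) (Fin n) ℂ) (q : ℝ) : ℝ :=
  ∫ ω, capacity (H ω) q ∂P

/-- `g = (1 / N_0) ∑_{k=1}^K ∑_{ℓ=1}^{N_0} ∑_{r=1}^{N_k - ℓ} 1 / r`, used when
`1 ≤ N_0 ≤ N_k` for all `k ≤ K`. -/
noncomputable def gConst (K : ℕ) (N : ℕ → ℕ) : ℝ :=
  (1 / (N 0 : ℝ)) * ∑ k ∈ Finset.Icc 1 K, ∑ l ∈ Finset.Icc 1 (N 0),
    ∑ r ∈ Finset.Icc 1 (N k - l), (1 / (r : ℝ))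

/-- The lower bound `N_0 ln (1 + q exp (g - K γ))` for the ergodic capacity. -/
noncomputable def capacityLowerBound (K : ℕ) (N : ℕ → ℕ) (q : ℝ) : ℝ :=
  (N 0 : ℝ) *
    Real.log (1 + q * Real.exp (gConst K N - (K : ℝ) * Real.eulerMascheroniConstant))

/-
Given a matrix `A` of full column rank, write `A = W T` with `W` an isometry. Right multiplication
by `W` turns a Gaussian matrix `G` into a smaller Gaussian matrix, so `det ((GA)ᴴ GA)` is
`det (Aᴴ A)` times an independent copy of a Gaussian Gram determinant. Projecting a column onto the
orthogonal complement of the preceding ones shows likewise that a Gaussian Gram determinant is a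
product of independent Gamma variables of integer shape `n + 1`, whose logarithms have mean
`ψ (n + 1) = harmonic n - γ`. Summing these means gives `E ln det (Hᴴ H) = N₀ (g - K γ)`.

In terms of the squared singular values `d` of `H`, the capacity is `∑ ln (1 + q d)`. The function
`x ↦ ln (1 + q exp x)` is convex, and integrating its tangent line at `g - K γ` gives the lower
bound. For `q ≥ 1`, `ln det (Hᴴ H) ≤ capacity H q - N₀ ln q ≤ capacity H 1`, so the limit follows by
dominated convergence.
-/

section Gamma

variable {a r t : ℝ}

lemma measurable_gammaPDF (a r : ℝ) : Measurable (gammaPDF a r) :=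
  (measurable_gammaPDFReal a r).ennreal_ofReal

lemma ae_pos_gammaMeasure (a r : ℝ) : ∀ᵐ x ∂gammaMeasure a r, 0 < x := by
  rw [gammaMeasure, ae_withDensity_iff (measurable_gammaPDF a r)]
  filter_upwards [Measure.ae_ne volume 0] with x hx hpdf
  by_contra hneg
  exact hpdf (gammaPDF_of_neg (lt_of_le_of_ne (not_lt.1 hneg) hx))

lemma lintegral_rpow_gammaMeasure (ha : 0 < a) (hr : 0 < r) (hat : 0 < a + t) :
    ∫⁻ x, ENNReal.ofReal (x ^ t) ∂gammaMeasure a r =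
      ENNReal.ofReal (Real.Gamma (a + t) / (Real.Gamma a * r ^ t)) := by
  have tilt : ∀ᵐ x : ℝ, (gammaPDF a r * fun x => ENNReal.ofReal (x ^ t)) x =
      ENNReal.ofReal (Real.Gamma (a + t) / (Real.Gamma a * r ^ t)) * gammaPDF (a + t) r x := by
    filter_upwards [Measure.ae_ne volume 0] with x hx
    rcases hx.lt_or_gt with hx | hx
    · simp [gammaPDF_of_neg hx]
    · rw [Pi.mul_apply, gammaPDF_of_nonneg hx.le, gammaPDF_of_nonneg hx.le,
        ← ENNReal.ofReal_mul (by positivity), ← ENNReal.ofReal_mul (by positivity),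
        Real.rpow_add hr, show a + t - 1 = a - 1 + t by ring, Real.rpow_add hx]
      congr 1
      field_simp
  rw [gammaMeasure, lintegral_withDensity_eq_lintegral_mul _ (measurable_gammaPDF a r)
    (by fun_prop), lintegral_congr_ae tilt, lintegral_const_mul _ (measurable_gammaPDF _ r),
    lintegral_gammaPDF_eq_one hat hr, mul_one]

lemma ae_rpow_nonneg_gammaMeasure (a r t : ℝ) : 0 ≤ᵐ[gammaMeasure a r] fun x => x ^ t :=
  (ae_pos_gammaMeasure a r).mono fun _ hx => (Real.rpow_pos_of_pos hx t).le

lemma integrable_rpow_gammaMeasure (ha : 0 < a) (hr : 0 < r) (hat : 0 < a + t) :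
    Integrable (fun x => x ^ t) (gammaMeasure a r) := by
  rw [← lintegral_ofReal_ne_top_iff_integrable (by fun_prop) (ae_rpow_nonneg_gammaMeasure a r t),
    lintegral_rpow_gammaMeasure ha hr hat]
  exact ENNReal.ofReal_ne_top

lemma integral_rpow_gammaMeasure (ha : 0 < a) (hr : 0 < r) (hat : 0 < a + t) :
    ∫ x, x ^ t ∂gammaMeasure a r = Real.Gamma (a + t) / (Real.Gamma a * r ^ t) := by
  rw [integral_eq_lintegral_of_nonneg_ae (ae_rpow_nonneg_gammaMeasure a r t) (by fun_prop),
    lintegral_rpow_gammaMeasure ha hr hat, ENNReal.toReal_ofReal (by positivity)]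

lemma exp_mul_log_ae_eq_gammaMeasure (a r t : ℝ) :
    (fun x => Real.exp (t * Real.log x)) =ᵐ[gammaMeasure a r] fun x => x ^ t :=
  (ae_pos_gammaMeasure a r).mono fun x hx => by
    simp only [Real.rpow_def_of_pos hx, mul_comm]

lemma zero_mem_interior_integrableExpSet_log_gammaMeasure (ha : 0 < a) (hr : 0 < r) :
    0 ∈ interior (integrableExpSet Real.log (gammaMeasure a r)) := by
  refine mem_interior.2 ⟨Set.Ioi (-a), fun t ht => ?_, isOpen_Ioi, neg_lt_zero.2 ha⟩
  exact (integrable_congr (exp_mul_log_ae_eq_gammaMeasure a r t)).2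
    (integrable_rpow_gammaMeasure ha hr (neg_lt_iff_pos_add'.1 ht))

lemma integral_log_gammaMeasure (ha : 0 < a) (hr : 0 < r) :
    ∫ x, Real.log x ∂gammaMeasure a r = logDeriv Real.Gamma a - Real.log r := by
  have hmgf : mgf Real.log (gammaMeasure a r) =ᶠ[𝓝 0]
      fun t => Real.Gamma (a + t) / (Real.Gamma a * r ^ t) := by
    filter_upwards [Ioi_mem_nhds (neg_lt_zero.2 ha)] with t ht
    exact (integral_congr_ae (exp_mul_log_ae_eq_gammaMeasure a r t)).trans
      (integral_rpow_gammaMeasure ha hr (neg_lt_iff_pos_add'.1 ht))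
  have hΓ : Real.Gamma a ≠ 0 := (Real.Gamma_pos_of_pos ha).ne'
  have hnum : HasDerivAt (fun t => Real.Gamma (a + t)) (deriv Real.Gamma a) 0 := by
    have hdiff : DifferentiableAt ℝ Real.Gamma (a + 0) :=
      Real.differentiableAt_Gamma fun m => by
        have := Nat.cast_nonneg (α := ℝ) m
        linarith
    simpa using hdiff.hasDerivAt.comp_const_add a 0
  have hden : HasDerivAt (fun t : ℝ => Real.Gamma a * r ^ t) (Real.Gamma a * Real.log r) 0 := by
    simpa using ((hasDerivAt_id (0 : ℝ)).const_rpow hr).const_mul (Real.Gamma a)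
  rw [← deriv_mgf_zero (zero_mem_interior_integrableExpSet_log_gammaMeasure ha hr),
    hmgf.deriv_eq, (hnum.fun_div hden (by simpa using hΓ)).deriv, logDeriv_apply]
  simp only [Real.rpow_zero, mul_one, add_zero]
  field_simp

lemma logDeriv_Gamma_nat_add_one (n : ℕ) :
    logDeriv Real.Gamma (n + 1) = harmonic n - Real.eulerMascheroniConstant := by
  rw [logDeriv_apply, Real.deriv_Gamma_nat, Real.Gamma_nat_eq_factorial,
    mul_div_cancel_left₀ _ (by positivity), neg_add_eq_sub]

lemma gammaPDF_mul_gammaPDF_one (ha : 0 < a) (hr : 0 < r) (x y : ℝ) :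
    gammaPDF a r y * gammaPDF 1 r (-y + x) = (Set.Icc 0 x).indicator (fun y =>
      ENNReal.ofReal (r ^ (a + 1) / Real.Gamma a * Real.exp (-(r * x)) * y ^ (a - 1))) y := by
  by_cases hy : 0 ≤ y
  · by_cases hyx : y ≤ x
    · rw [Set.indicator_of_mem (Set.mem_Icc.2 ⟨hy, hyx⟩), gammaPDF_of_nonneg hy,
        gammaPDF_of_nonneg (by linarith), ← ENNReal.ofReal_mul (by positivity),
        Real.rpow_add_one hr.ne', show -(r * x) = -(r * y) + -(r * (-y + x)) by ring, Real.exp_add,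
        Real.Gamma_one, sub_self, Real.rpow_zero, Real.rpow_one]
      congr 1
      ring
    · rw [gammaPDF_of_neg (x := -y + x) (by linarith), mul_zero,
        Set.indicator_of_notMem fun h => hyx h.2]
  · rw [gammaPDF_of_neg (not_le.1 hy), zero_mul, Set.indicator_of_notMem fun h => hy h.1]

lemma lintegral_Icc_rpow_sub_one (ha : 0 < a) {x : ℝ} (hx : 0 ≤ x) :
    ∫⁻ y in Set.Icc 0 x, ENNReal.ofReal (y ^ (a - 1)) = ENNReal.ofReal (x ^ a / a) := by
  have hint : IntervalIntegrable (fun y : ℝ => y ^ (a - 1)) volume 0 x :=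
    intervalIntegral.intervalIntegrable_rpow' (by linarith)
  rw [← restrict_Ioc_eq_restrict_Icc, ← ofReal_integral_eq_lintegral_ofReal hint.1,
    ← intervalIntegral.integral_of_le hx, integral_rpow (Or.inl (by linarith)), sub_add_cancel,
    Real.zero_rpow ha.ne', sub_zero]
  filter_upwards [ae_restrict_mem measurableSet_Ioc] with y hy using Real.rpow_nonneg hy.1.le _

lemma gammaMeasure_conv_expMeasure (ha : 0 < a) (hr : 0 < r) :
    gammaMeasure a r ∗ expMeasure r = gammaMeasure (a + 1) r := by
  rw [expMeasure, gammaMeasure, gammaMeasure, conv_withDensity_eq_lconvolution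
    (measurable_gammaPDF a r) (measurable_gammaPDF 1 r), gammaMeasure]
  congr 1 with x
  simp_rw [lconvolution_def, gammaPDF_mul_gammaPDF_one ha hr,
    lintegral_indicator measurableSet_Icc]
  rcases lt_or_ge x 0 with hx | hx
  · rw [Set.Icc_eq_empty (not_le.2 hx), Measure.restrict_empty, lintegral_zero_measure,
      gammaPDF_of_neg hx]
  · have hC : 0 ≤ r ^ (a + 1) / Real.Gamma a * Real.exp (-(r * x)) := by positivity
    simp_rw [ENNReal.ofReal_mul hC]
    rw [lintegral_const_mul _ (by fun_prop), lintegral_Icc_rpow_sub_one ha hx,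
      ← ENNReal.ofReal_mul hC, gammaPDF_of_nonneg hx, Real.Gamma_add_one ha.ne',
      add_sub_cancel_right]
    congr 1
    field_simp

end Gamma

section StdComplexGaussian

lemma integral_stdComplexGaussian {E : Type*} [NormedAddCommGroup E] [NormedSpace ℝ E]
    (f : ℂ → E) :
    ∫ z, f z ∂stdComplexGaussian = ∫ z : ℂ, (Real.exp (-‖z‖ ^ 2) / Real.pi) • f z := by
  rw [stdComplexGaussian, integral_withDensity_eq_integral_toReal_smul (by fun_prop)
    (ae_of_all _ fun _ => ENNReal.ofReal_lt_top)]
  refine integral_congr_ae (ae_of_all _ fun z => ?_)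
  simp only
  rw [ENNReal.toReal_ofReal (by positivity)]

lemma integral_cexp_quadratic_stdComplexGaussian {w : ℂ} (hw : w.re < 1) (c : ℂ) (u : ℂ) :
    ∫ z, Complex.exp (w * ‖z‖ ^ 2 + c * inner ℝ u z) ∂stdComplexGaussian =
      (1 - w)⁻¹ * Complex.exp (c ^ 2 * ‖u‖ ^ 2 / (4 * (1 - w))) := by
  have hb : 0 < (1 - w).re := by simpa using hw
  have hπ : (Real.pi : ℂ) ≠ 0 := by exact_mod_cast Real.pi_ne_zero
  have hcomplete (z : ℂ) : (Real.exp (-‖z‖ ^ 2) / Real.pi) •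
      Complex.exp (w * ‖z‖ ^ 2 + c * inner ℝ u z) =
      (Real.pi : ℂ)⁻¹ * Complex.exp (-(1 - w) * ‖z‖ ^ 2 + c * inner ℝ u z) := by
    rw [Complex.real_smul, Complex.ofReal_div, Complex.ofReal_exp, div_mul_eq_mul_div,
      ← Complex.exp_add, div_eq_inv_mul]
    push_cast
    ring_nf
  rw [integral_stdComplexGaussian]
  simp_rw [hcomplete]
  rw [integral_const_mul, GaussianFourier.integral_cexp_neg_mul_sq_norm_add hb,
    Complex.finrank_real_complex, Nat.cast_ofNat, div_self two_ne_zero, Complex.cpow_one,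
    ← mul_assoc, div_eq_mul_inv, inv_mul_cancel_left₀ hπ]

instance isProbabilityMeasure_stdComplexGaussian : IsProbabilityMeasure stdComplexGaussian := by
  have h := integral_cexp_quadratic_stdComplexGaussian (w := 0) zero_lt_one 0 0
  simp only [zero_mul, add_zero, Complex.exp_zero, integral_const, Complex.real_smul, mul_one,
    sub_zero, inv_one, norm_zero, ne_eq, OfNat.ofNat_ne_zero, not_false_eq_true, zero_pow,
    zero_div] at h
  exact ⟨(ENNReal.toReal_eq_one_iff _).1 (by exact_mod_cast h)⟩

lemma charFunDual_stdComplexGaussian (L : StrongDual ℝ ℂ) (u : ℂ) (hL : ∀ z, L z = inner ℝ u z) :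
    charFunDual stdComplexGaussian L = Complex.exp (-‖u‖ ^ 2 / 4) := by
  have h := integral_cexp_quadratic_stdComplexGaussian (w := 0) zero_lt_one Complex.I u
  simp only [zero_mul, zero_add, sub_zero, inv_one, one_mul, mul_one, Complex.I_sq, neg_one_mul]
    at h
  simp only [charFunDual_apply, hL, mul_comm _ Complex.I, h]

lemma integral_cexp_mul_expMeasure_one {w : ℂ} (hw : w.re < 1) :
    ∫ x, Complex.exp (w * x) ∂expMeasure 1 = (1 - w)⁻¹ := by
  have hdensity (x : ℝ) : (gammaPDF 1 1 x).toReal • Complex.exp (w * x) =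
      (Set.Ici 0).indicator (fun x : ℝ => Complex.exp ((w - 1) * x)) x := by
    by_cases hx : 0 ≤ x
    · rw [gammaPDF_of_nonneg hx, ENNReal.toReal_ofReal (by positivity),
        Set.indicator_of_mem (Set.mem_Ici.2 hx), Complex.real_smul]
      simp only [Real.rpow_one, Real.Gamma_one, div_one, sub_self, Real.rpow_zero, one_mul,
        Complex.ofReal_exp, ← Complex.exp_add]
      push_cast
      ring_nf
    · rw [gammaPDF_of_neg (not_le.1 hx), Set.indicator_of_notMem (by simpa using hx),
        ENNReal.toReal_zero, zero_smul]
  rw [expMeasure, gammaMeasure, integral_withDensity_eq_integral_toReal_smul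
    (measurable_gammaPDF 1 1) (ae_of_all _ fun _ => ENNReal.ofReal_lt_top)]
  simp_rw [hdensity]
  rw [integral_indicator measurableSet_Ici, integral_Ici_eq_integral_Ioi,
    integral_exp_mul_complex_Ioi (by simpa using hw), Complex.ofReal_zero, mul_zero,
    Complex.exp_zero, neg_div, ← div_neg, neg_sub, one_div]

lemma map_norm_sq_stdComplexGaussian :
    stdComplexGaussian.map (fun z => ‖z‖ ^ 2) = expMeasure 1 := by
  have : IsProbabilityMeasure (stdComplexGaussian.map (fun z => ‖z‖ ^ 2)) :=
    Measure.isProbabilityMeasure_map (by fun_prop)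
  have : IsProbabilityMeasure (expMeasure 1) := isProbabilityMeasure_expMeasure one_pos
  refine Measure.ext_of_charFun (funext fun t => ?_)
  have hw : (t * Complex.I).re < 1 := by simp
  have h := integral_cexp_quadratic_stdComplexGaussian hw 0 0
  have h' := integral_cexp_mul_expMeasure_one hw
  simp only [zero_mul, add_zero, ne_eq, OfNat.ofNat_ne_zero, not_false_eq_true, zero_pow,
    zero_div, Complex.exp_zero, mul_one] at h
  rw [charFun_apply_real, charFun_apply_real, integral_map (by fun_prop) (by fun_prop)]
  simp only [Complex.ofReal_pow, mul_right_comm _ _ Complex.I, h, h']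

end StdComplexGaussian

section GaussianVector

variable {ι κ : Type*} [Fintype ι] [Fintype κ]

/-- The law of a family of independent standard complex Gaussian variables indexed by `ι`. -/
noncomputable abbrev gaussianVector (ι : Type*) [Fintype ι] : Measure (ι → ℂ) :=
  Measure.pi fun _ => stdComplexGaussian

lemma map_sum_norm_sq_gaussianVector_fin (n : ℕ) :
    (gaussianVector (Fin (n + 1))).map (fun x => ∑ i, ‖x i‖ ^ 2) = gammaMeasure (n + 1) 1 := by
  induction n with
  | zero =>
    have h := measurePreserving_eval (fun _ : Fin 1 => stdComplexGaussian) 0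
    have hexp : gammaMeasure ((0 : ℕ) + 1) 1 = expMeasure 1 := by
      rw [Nat.cast_zero, zero_add, expMeasure]
    rw [hexp, ← map_norm_sq_stdComplexGaussian, ← h.map_eq,
      Measure.map_map (by fun_prop) h.measurable]
    simp [Function.comp_def]
  | succ n ih =>
    have := isProbabilityMeasure_expMeasure one_pos
    have := isProbabilityMeasure_gammaMeasure (n.cast_add_one_pos (α := ℝ)) one_pos
    have hsplit := measurePreserving_piFinSuccAbove
      (fun _ : Fin (n + 2) => stdComplexGaussian) (Fin.last _)
    have hsum : (fun x : Fin (n + 2) → ℂ => ∑ i, ‖x i‖ ^ 2) =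
        (fun p : ℝ × ℝ => p.2 + p.1) ∘ Prod.map (fun z => ‖z‖ ^ 2) (fun y => ∑ i, ‖y i‖ ^ 2) ∘
          MeasurableEquiv.piFinSuccAbove (fun _ => ℂ) (Fin.last _) := by
      funext x
      exact (Fin.sum_univ_succAbove _ (Fin.last _)).trans (add_comm _ _)
    rw [hsum, ← Measure.map_map (by fun_prop) (by fun_prop), ← Measure.map_map (by fun_prop)
      hsplit.measurable, hsplit.map_eq, ← Measure.map_prod_map _ _ (by fun_prop) (by fun_prop),
      map_norm_sq_stdComplexGaussian, ih, ← Measure.prod_swap, Measure.map_map (by fun_prop)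
      (by fun_prop)]
    push_cast
    exact gammaMeasure_conv_expMeasure (by positivity) one_pos

lemma map_sum_norm_sq_gaussianVector [Nonempty ι] :
    (gaussianVector ι).map (fun x => ∑ i, ‖x i‖ ^ 2) = gammaMeasure (Fintype.card ι) 1 := by
  obtain ⟨n, hn⟩ := Nat.exists_eq_add_one.2 (Fintype.card_pos (α := ι))
  have h := measurePreserving_piCongrLeft (α := fun _ : ι => ℂ) (fun _ => stdComplexGaussian)
    (Fintype.equivFinOfCardEq hn).symm
  rw [hn, Nat.cast_add_one, ← map_sum_norm_sq_gaussianVector_fin, gaussianVector, ← h.map_eq,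
    Measure.map_map (by fun_prop) h.measurable]
  congr 1 with x
  exact Fintype.sum_equiv (Fintype.equivFinOfCardEq hn) _ _ fun i => by
    simp [MeasurableEquiv.piCongrLeft, Equiv.piCongrLeft_apply]

lemma charFunDual_gaussianVector (L : StrongDual ℝ (ι → ℂ)) (c : ι → ℂ)
    (hL : ∀ x, L x = (star c ⬝ᵥ x).re) :
    charFunDual (gaussianVector ι) L = Complex.exp (-(star c ⬝ᵥ c).re / 4) := by
  classical
  have hcoord (i : ι) := charFunDual_stdComplexGaussian
    (L.comp (ContinuousLinearMap.single ℝ (fun _ : ι => ℂ) i)) (c i) fun z => by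
      simp [hL, Complex.inner, mul_comm]
  have hnorm : (star c ⬝ᵥ c).re = ∑ i, ‖c i‖ ^ 2 := by
    simp [dotProduct, Complex.sq_norm, Complex.normSq_apply]
  simp_rw [charFunDual_pi, hcoord]
  rw [← Complex.exp_sum, hnorm, ← Finset.sum_div, Finset.sum_neg_distrib]
  push_cast
  rfl

lemma exists_eq_re_dotProduct (L : StrongDual ℝ (ι → ℂ)) :
    ∃ c : ι → ℂ, ∀ x, L x = (star c ⬝ᵥ x).re := by
  classical
  refine ⟨fun i => L (Pi.single i 1) + L (Pi.single i Complex.I) * Complex.I, fun x => ?_⟩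
  have hx : x = ∑ i, ((x i).re • (Pi.single i 1 : ι → ℂ) +
      (x i).im • (Pi.single i Complex.I : ι → ℂ)) := by
    ext j
    simp [Pi.single_apply, Finset.sum_apply, Finset.sum_add_distrib]
  conv_lhs => rw [hx]
  simp only [map_sum, map_add, map_smul, dotProduct, Complex.re_sum]
  refine Finset.sum_congr rfl fun i _ => ?_
  simp [mul_comm]

lemma map_mulVec_gaussianVector [DecidableEq κ] {M : Matrix κ ι ℂ} (hM : M * Mᴴ = 1) :
    (gaussianVector ι).map (fun x => M *ᵥ x) = gaussianVector κ := by
  let T : (ι → ℂ) →L[ℝ] (κ → ℂ) := (M.mulVecLin.restrictScalars ℝ).toContinuousLinearMap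
  have : IsProbabilityMeasure ((gaussianVector ι).map T) :=
    Measure.isProbabilityMeasure_map T.continuous.aemeasurable
  change (gaussianVector ι).map T = _
  refine Measure.ext_of_charFunDual (funext fun L => ?_)
  obtain ⟨c, hc⟩ := exists_eq_re_dotProduct L
  have hLT (x : ι → ℂ) : (L.comp T) x = (star (Mᴴ *ᵥ c) ⬝ᵥ x).re := by
    rw [Matrix.star_mulVec, Matrix.conjTranspose_conjTranspose, ← Matrix.dotProduct_mulVec]
    exact hc _
  rw [charFunDual_map, charFunDual_gaussianVector L c hc, charFunDual_gaussianVector _ _ hLT,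
    Matrix.star_mulVec, Matrix.conjTranspose_conjTranspose, Matrix.dotProduct_mulVec,
    Matrix.vecMul_vecMul, hM, Matrix.vecMul_one]

end GaussianVector

section MatrixMeasurableSpace

variable {m n : Type*}

/-- Matrices carry the product `σ`-algebra of their entries. -/
noncomputable instance matrixMeasurableSpace : MeasurableSpace (Matrix m n ℂ) :=
  inferInstanceAs (MeasurableSpace (m → n → ℂ))

instance matrixBorelSpace [Countable m] [Countable n] : BorelSpace (Matrix m n ℂ) :=
  inferInstanceAs (BorelSpace (m → n → ℂ))

instance matrixSecondCountableTopology [Countable m] [Countable n] :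
    SecondCountableTopology (Matrix m n ℂ) :=
  inferInstanceAs (SecondCountableTopology (m → n → ℂ))

lemma continuous_fromCols {p : Type*} :
    Continuous fun A : Matrix m n ℂ × Matrix m p ℂ => Matrix.fromCols A.1 A.2 :=
  continuous_matrix fun i => Sum.rec (fun j => continuous_fst.matrix_elem i j)
    fun j => continuous_snd.matrix_elem i j

lemma continuous_snd_mul_fst [Fintype m] {p : Type*} :
    Continuous fun z : Matrix m n ℂ × Matrix p m ℂ => z.2 * z.1 :=
  continuous_snd.matrix_mul continuous_fst

lemma continuous_of_curry :
    Continuous fun x : m × n → ℂ => Matrix.of (Function.curry x) :=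
  continuous_matrix fun i j => continuous_apply (i, j)

end MatrixMeasurableSpace

section GaussianMatrix

open scoped Kronecker

variable {m n p q : Type*} [Fintype m] [Fintype n] [Fintype p] [Fintype q]

/-- The law of an `m × n` matrix with independent standard complex Gaussian entries. -/
noncomputable def gaussianMatrix (m n : Type*) [Fintype m] [Fintype n] : Measure (Matrix m n ℂ) :=
  (gaussianVector (m × n)).map fun x => Matrix.of (Function.curry x)

instance : IsProbabilityMeasure (gaussianMatrix m n) :=
  Measure.isProbabilityMeasure_map continuous_of_curry.aemeasurable

lemma map_mul_mul_gaussianMatrix [DecidableEq m] [DecidableEq q] {B : Matrix m n ℂ}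
    (hB : B * Bᴴ = 1) {W : Matrix p q ℂ} (hW : Wᴴ * W = 1) :
    (gaussianMatrix n p).map (fun G => B * G * W) = gaussianMatrix m q := by
  have hWt : Wᵀ * Wᵀᴴ = 1 := by
    rw [← Matrix.transpose_one, ← hW, Matrix.transpose_mul]; rfl
  have hBW : (B ⊗ₖ Wᵀ) * (B ⊗ₖ Wᵀ)ᴴ = 1 := by
    rw [Matrix.conjTranspose_kronecker, ← Matrix.mul_kronecker_mul, hB, hWt,
      Matrix.one_kronecker_one]
  have hvec (x : n × p → ℂ) : B * Matrix.of (Function.curry x) * W =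
      Matrix.of (Function.curry ((B ⊗ₖ Wᵀ) *ᵥ x)) := by
    ext i j
    have h := congrFun (Matrix.kronecker_mulVec_vec Wᵀ (Matrix.of (Function.curry x))ᵀ B) (i, j)
    rw [← Matrix.transpose_mul, ← Matrix.transpose_mul, ← Matrix.mul_assoc] at h
    exact h.symm
  have hmul : Measurable fun G : Matrix n p ℂ => B * G * W :=
    ((continuous_const.matrix_mul continuous_id).matrix_mul continuous_const).measurable
  have hmulVec : Measurable fun x : n × p → ℂ => (B ⊗ₖ Wᵀ) *ᵥ x :=
    (continuous_const.matrix_mulVec continuous_id).measurable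
  rw [gaussianMatrix, gaussianMatrix, ← map_mulVec_gaussianVector hBW,
    Measure.map_map hmul continuous_of_curry.measurable,
    Measure.map_map continuous_of_curry.measurable hmulVec]
  simp only [Function.comp_def, hvec]

lemma map_mul_left_gaussianMatrix [DecidableEq m] {B : Matrix m n ℂ} (hB : B * Bᴴ = 1) :
    (gaussianMatrix n p).map (fun G => B * G) = gaussianMatrix m p := by
  classical simpa using map_mul_mul_gaussianMatrix (p := p) hB (W := (1 : Matrix p p ℂ)) (by simp)

lemma map_mul_right_gaussianMatrix [DecidableEq q] {W : Matrix p q ℂ} (hW : Wᴴ * W = 1) :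
    (gaussianMatrix n p).map (fun G => G * W) = gaussianMatrix n q := by
  classical simpa using map_mul_mul_gaussianMatrix (n := n) (B := (1 : Matrix n n ℂ)) (by simp) hW

lemma map_fromCols_prod_gaussianMatrix :
    ((gaussianMatrix m n).prod (gaussianMatrix m p)).map (fun A => Matrix.fromCols A.1 A.2) =
      gaussianMatrix m (n ⊕ p) := by
  have hsum := (measurePreserving_sumPiEquivProdPi (X := fun _ : m × n ⊕ m × p => ℂ)
    fun _ => stdComplexGaussian).symm
  have hdistrib := measurePreserving_piCongrLeft (α := fun _ : m × (n ⊕ p) => ℂ)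
    (fun _ => stdComplexGaussian) (Equiv.prodSumDistrib m n p).symm
  have hn := (continuous_of_curry (m := m) (n := n)).measurable
  have hp := (continuous_of_curry (m := m) (n := p)).measurable
  have hnp := (continuous_of_curry (m := m) (n := n ⊕ p)).measurable
  simp only [gaussianMatrix, gaussianVector]
  rw [← hdistrib.map_eq, ← hsum.map_eq, Measure.map_prod_map _ _ hn hp,
    Measure.map_map continuous_fromCols.measurable (hn.prodMap hp),
    Measure.map_map hdistrib.measurable hsum.measurable,
    Measure.map_map hnp (hdistrib.measurable.comp hsum.measurable)]
  congr 1
  ext x i (j | j) <;> rfl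

lemma map_submatrix_gaussianMatrix (e : p ≃ n) :
    (gaussianMatrix m n).map (fun G => G.submatrix id e) = gaussianMatrix m p := by
  classical
  have hW : ((1 : Matrix n n ℂ).submatrix id e)ᴴ * (1 : Matrix n n ℂ).submatrix id e = 1 := by
    rw [Matrix.conjTranspose_submatrix, Matrix.conjTranspose_one,
      ← Matrix.submatrix_mul _ _ _ _ _ Function.bijective_id, mul_one, Matrix.submatrix_one_equiv]
  have hmul (G : Matrix m n ℂ) : G * (1 : Matrix n n ℂ).submatrix id e = G.submatrix id e := by
    nth_rw 1 [← G.submatrix_id_id]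
    rw [← Matrix.submatrix_mul _ _ _ _ _ Function.bijective_id, Matrix.mul_one]
  simpa only [hmul] using map_mul_right_gaussianMatrix (n := m) hW

end GaussianMatrix

section GramDet

variable {m n k l : Type*} [Fintype m] [Fintype n] [DecidableEq n]

/-- The Gram determinant `det (Aᴴ A)` of the columns of a complex matrix. -/
noncomputable def gramDet (A : Matrix m n ℂ) : ℝ :=
  (Aᴴ * A).det.re

lemma continuous_gramDet : Continuous (gramDet : Matrix m n ℂ → ℝ) :=
  Complex.continuous_re.comp
    (continuous_id.matrix_conjTranspose.matrix_mul continuous_id).matrix_det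

lemma ofReal_gramDet (A : Matrix m n ℂ) : (gramDet A : ℂ) = (Aᴴ * A).det := by
  refine Complex.conj_eq_iff_re.1 ?_
  rw [starRingEnd_apply, ← Matrix.det_conjTranspose, Matrix.conjTranspose_mul,
    Matrix.conjTranspose_conjTranspose]

lemma gramDet_mul (A : Matrix m n ℂ) (T : Matrix n n ℂ) :
    gramDet (A * T) = gramDet T * gramDet A := by
  refine Complex.ofReal_injective ?_
  rw [Complex.ofReal_mul, ofReal_gramDet, ofReal_gramDet, ofReal_gramDet, Matrix.conjTranspose_mul,
    Matrix.mul_assoc, ← Matrix.mul_assoc Aᴴ, Matrix.det_mul, Matrix.det_mul, Matrix.det_mul]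
  ring

lemma gramDet_eq_one_of_isometry {W : Matrix m n ℂ} (hW : Wᴴ * W = 1) : gramDet W = 1 := by
  rw [gramDet, hW, Matrix.det_one, Complex.one_re]

lemma gramDet_submatrix [Fintype k] [DecidableEq k] (A : Matrix m n ℂ) (e : k ≃ n) :
    gramDet (A.submatrix id e) = gramDet A := by
  rw [gramDet, gramDet, ← Matrix.det_submatrix_equiv_self e (Aᴴ * A)]
  rfl

lemma gramDet_of_unique [Unique n] (A : Matrix m n ℂ) : gramDet A = ∑ i, ‖A i default‖ ^ 2 := by
  rw [gramDet, Matrix.det_unique, Matrix.mul_apply, Complex.re_sum]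
  refine Finset.sum_congr rfl fun i _ => ?_
  simp [Complex.sq_norm, Complex.normSq_apply]

open scoped ComplexOrder MatrixOrder in
lemma exists_isometry_mul {A : Matrix m n ℂ} (hA : gramDet A ≠ 0) :
    ∃ (W : Matrix m n ℂ) (T : Matrix n n ℂ), Wᴴ * W = 1 ∧ A = W * T := by
  obtain ⟨T, hT⟩ : ∃ T : Matrix n n ℂ, Aᴴ * A = Tᴴ * T :=
    CStarAlgebra.nonneg_iff_eq_star_mul_self.1 (Matrix.posSemidef_conjTranspose_mul_self A).nonneg
  have hdet : IsUnit T.det := by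
    rw [isUnit_iff_ne_zero]
    intro h
    rw [gramDet, hT, Matrix.det_mul, h, mul_zero] at hA
    exact hA rfl
  refine ⟨A * T⁻¹, T, ?_, ?_⟩
  · rw [Matrix.conjTranspose_mul, Matrix.mul_assoc, ← Matrix.mul_assoc Aᴴ, hT, Matrix.mul_assoc,
      Matrix.mul_nonsing_inv _ hdet, Matrix.mul_one, ← Matrix.conjTranspose_mul,
      Matrix.mul_nonsing_inv _ hdet, Matrix.conjTranspose_one]
  · rw [Matrix.mul_assoc, Matrix.nonsing_inv_mul _ hdet, Matrix.mul_one]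

lemma exists_isometry_complement [Fintype l] [DecidableEq l] [DecidableEq m] {W : Matrix m n ℂ}
    (hW : Wᴴ * W = 1) (hcard : Fintype.card m = Fintype.card n + Fintype.card l) :
    ∃ V : Matrix m l ℂ, Vᴴ * V = 1 ∧ W * Wᴴ + V * Vᴴ = 1 := by
  let w : n ⊕ l → EuclideanSpace ℂ m := Sum.elim (fun j => WithLp.toLp 2 (W.col j)) 0
  have hw : Orthonormal ℂ ((Set.range Sum.inl).domRestrict w) := by
    refine orthonormal_iff_ite.2 ?_
    rintro ⟨_, i, rfl⟩ ⟨_, j, rfl⟩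
    have h := congrFun (congrFun hW i) j
    rw [Matrix.mul_apply, Matrix.one_apply] at h
    rw [if_congr (Subtype.ext_iff.trans Sum.inl_injective.eq_iff) rfl rfl]
    simpa [w, PiLp.inner_apply, mul_comm] using h
  obtain ⟨b, hb⟩ := hw.exists_orthonormalBasis_extension_of_card_eq (by simp [hcard])
  let U : Matrix m (n ⊕ l) ℂ := Matrix.of fun i j => b j i
  have hU : Uᴴ * U = 1 := by
    ext i j
    have h := orthonormal_iff_ite.1 b.orthonormal i j
    rw [PiLp.inner_apply] at h
    simpa [U, Matrix.mul_apply, Matrix.one_apply, mul_comm] using h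
  have hUW : U = Matrix.fromCols W U.toCols₂ := by
    ext i (j | j)
    · simp [U, hb (Sum.inl j) ⟨j, rfl⟩, w]
    · rfl
  have hU' : U * Uᴴ = 1 := (Matrix.mul_eq_one_comm_of_card_eq _ _ _ (by simp [hcard])).1 hU
  rw [hUW, Matrix.conjTranspose_fromCols_eq_fromRows_conjTranspose] at hU hU'
  rw [Matrix.fromRows_mul_fromCols, ← Matrix.fromBlocks_one, Matrix.fromBlocks_inj] at hU
  rw [Matrix.fromCols_mul_fromRows] at hU'
  exact ⟨U.toCols₂, hU.2.2.2, hU'⟩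

lemma gramDet_fromCols [Fintype k] [DecidableEq k] [Fintype l] [DecidableEq m] {W : Matrix m k ℂ}
    (hW : Wᴴ * W = 1) (T : Matrix k k ℂ) {V : Matrix m l ℂ} (hWV : W * Wᴴ + V * Vᴴ = 1)
    (B : Matrix m n ℂ) :
    gramDet (Matrix.fromCols (W * T) B) = gramDet T * gramDet (Vᴴ * B) := by
  have hWT : (W * T)ᴴ * (W * T) = Tᴴ * T := by
    rw [Matrix.conjTranspose_mul, Matrix.mul_assoc, ← Matrix.mul_assoc Wᴴ, hW, Matrix.one_mul]
  have hBB : Bᴴ * B = Bᴴ * W * (Wᴴ * B) + (Vᴴ * B)ᴴ * (Vᴴ * B) := by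
    rw [Matrix.conjTranspose_mul, Matrix.conjTranspose_conjTranspose, Matrix.mul_assoc,
      Matrix.mul_assoc, ← Matrix.mul_assoc W, ← Matrix.mul_assoc V, ← Matrix.mul_add,
      ← Matrix.add_mul, hWV, Matrix.one_mul]
  have hfactor : (Matrix.fromCols (W * T) B)ᴴ * Matrix.fromCols (W * T) B =
      Matrix.fromBlocks Tᴴ 0 (Bᴴ * W) 1 *
        Matrix.fromBlocks T (Wᴴ * B) 0 ((Vᴴ * B)ᴴ * (Vᴴ * B)) := by
    rw [Matrix.conjTranspose_fromCols_eq_fromRows_conjTranspose, Matrix.fromRows_mul_fromCols,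
      Matrix.fromBlocks_multiply, hWT, hBB, Matrix.conjTranspose_mul]
    simp only [Matrix.mul_assoc, Matrix.zero_mul, Matrix.mul_zero, Matrix.one_mul, add_zero]
  refine Complex.ofReal_injective ?_
  rw [Complex.ofReal_mul, ofReal_gramDet, ofReal_gramDet, ofReal_gramDet, hfactor, Matrix.det_mul,
    Matrix.det_fromBlocks_zero₁₂, Matrix.det_fromBlocks_zero₂₁, Matrix.det_one, mul_one,
    ← mul_assoc, Matrix.det_mul]

end GramDet

section HasLogMean

/-- `μ` is the law of an almost surely positive random variable whose logarithm is integrable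
with mean `c`. -/
structure HasLogMean (μ : Measure ℝ) (c : ℝ) : Prop where
  ae_pos : ∀ᵐ x ∂μ, 0 < x
  integrable_log : Integrable Real.log μ
  integral_log : ∫ x, Real.log x ∂μ = c

lemma hasLogMean_map_iff {Ω : Type*} [MeasurableSpace Ω] {P : Measure Ω} {X : Ω → ℝ} {c : ℝ}
    (hX : AEMeasurable X P) : HasLogMean (P.map X) c ↔
      (∀ᵐ ω ∂P, 0 < X ω) ∧ Integrable (fun ω => Real.log (X ω)) P ∧
        ∫ ω, Real.log (X ω) ∂P = c := by
  rw [← ae_map_iff hX measurableSet_Ioi, ← integral_map hX (by fun_prop)]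
  exact ⟨fun h => ⟨h.ae_pos, h.integrable_log.comp_aemeasurable hX, h.integral_log⟩,
    fun h => ⟨h.1, (integrable_map_measure (by fun_prop) hX).2 h.2.1, h.2.2⟩⟩

lemma hasLogMean_dirac_one : HasLogMean (Measure.dirac 1) 0 where
  ae_pos := by simp
  integrable_log := integrable_dirac (by simp)
  integral_log := by simp

lemma hasLogMean_gammaMeasure (n : ℕ) :
    HasLogMean (gammaMeasure (n + 1) 1) (harmonic n - Real.eulerMascheroniConstant) where
  ae_pos := ae_pos_gammaMeasure _ _
  integrable_log := integrable_of_mem_interior_integrableExpSet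
    (zero_mem_interior_integrableExpSet_log_gammaMeasure n.cast_add_one_pos one_pos)
  integral_log := by
    rw [integral_log_gammaMeasure n.cast_add_one_pos one_pos, logDeriv_Gamma_nat_add_one,
      Real.log_one, sub_zero]

lemma HasLogMean.mconv {μ ν : Measure ℝ} [IsProbabilityMeasure μ] [IsProbabilityMeasure ν]
    {c d : ℝ} (hμ : HasLogMean μ c) (hν : HasLogMean ν d) : HasLogMean (μ ∗ₘ ν) (c + d) := by
  have hfst : Integrable (fun z : ℝ × ℝ => Real.log z.1) (μ.prod ν) :=
    hμ.integrable_log.comp_fst ν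
  have hsnd : Integrable (fun z : ℝ × ℝ => Real.log z.2) (μ.prod ν) :=
    hν.integrable_log.comp_snd μ
  have hpos : ∀ᵐ z ∂μ.prod ν, 0 < z.1 ∧ 0 < z.2 :=
    (Measure.quasiMeasurePreserving_fst.ae hμ.ae_pos).and
      (Measure.quasiMeasurePreserving_snd.ae hν.ae_pos)
  have hlog : (fun z : ℝ × ℝ => Real.log (z.1 * z.2)) =ᵐ[μ.prod ν]
      fun z => Real.log z.1 + Real.log z.2 :=
    hpos.mono fun z hz => Real.log_mul hz.1.ne' hz.2.ne'
  refine ⟨?_, ?_, ?_⟩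
  · rw [Measure.mconv, ae_map_iff (by fun_prop) measurableSet_Ioi]
    exact hpos.mono fun z hz => mul_pos hz.1 hz.2
  · rw [Measure.mconv, integrable_map_measure (by fun_prop) (by fun_prop)]
    exact (hfst.add hsnd).congr hlog.symm
  · rw [Measure.mconv, integral_map (by fun_prop) (by fun_prop), integral_congr_ae hlog,
      integral_add hfst hsnd, integral_fun_fst, integral_fun_snd, hμ.integral_log,
      hν.integral_log]
    simp

lemma map_prod_eq_mconv {α β : Type*} [MeasurableSpace α] [MeasurableSpace β] {μ : Measure α}
    {ν : Measure β} [SFinite ν] {ρ : Measure ℝ} [SFinite ρ] {D : α × β → ℝ}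
    (hD : Measurable D) {u : α → ℝ} (hu : Measurable u)
    (h : ∀ᵐ a ∂μ, ν.map (fun b => D (a, b)) = ρ.map (fun x => u a * x)) :
    (μ.prod ν).map D = (μ.map u) ∗ₘ ρ := by
  ext s hs
  rw [Measure.map_apply hD hs, Measure.prod_apply (hD hs), Measure.mconv,
    Measure.map_apply measurable_mul hs, Measure.prod_apply (measurable_mul hs),
    lintegral_map (measurable_measure_prodMk_left (measurable_mul hs)) hu]
  refine lintegral_congr_ae (h.mono fun a ha => ?_)
  have hDa : Measurable fun b => D (a, b) := by fun_prop
  have has := congrArg (· s) ha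
  simp only [Measure.map_apply hDa hs, Measure.map_apply (measurable_const_mul (u a)) hs] at has
  exact has

end HasLogMean

section GaussianGramDet

variable {m n k l p : Type*} [Fintype m] [Fintype n] [DecidableEq n]

lemma map_gramDet_gaussianMatrix_unique [Nonempty m] [Unique n] :
    (gaussianMatrix m n).map gramDet = gammaMeasure (Fintype.card m) 1 := by
  have hsum (x : m × n → ℂ) :
      gramDet (Matrix.of (Function.curry x)) = ∑ i, ‖x i‖ ^ 2 := by
    rw [gramDet_of_unique, Fintype.sum_prod_type]
    simp
  rw [gaussianMatrix, Measure.map_map continuous_gramDet.measurable continuous_of_curry.measurable]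
  simp only [Function.comp_def, hsum]
  rw [map_sum_norm_sq_gaussianVector, Fintype.card_prod, Fintype.card_unique (α := n), mul_one]

lemma map_gramDet_gaussianMatrix_congr [Fintype k] [DecidableEq k] (e : k ≃ n) :
    (gaussianMatrix m n).map gramDet = (gaussianMatrix m k).map gramDet := by
  have hsub : Measurable fun G : Matrix m n ℂ => G.submatrix id e :=
    (continuous_id.matrix_submatrix id e).measurable
  rw [← map_submatrix_gaussianMatrix e, Measure.map_map continuous_gramDet.measurable hsub]
  simp only [Function.comp_def, gramDet_submatrix]

lemma map_gramDet_gaussianMatrix_sum [Fintype k] [DecidableEq k] [Fintype l]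
    (hcard : Fintype.card m = Fintype.card k + Fintype.card l)
    (hpos : ∀ᵐ A ∂gaussianMatrix m k, gramDet A ≠ 0) :
    (gaussianMatrix m (k ⊕ n)).map gramDet =
      (gaussianMatrix m k).map gramDet ∗ₘ (gaussianMatrix l n).map gramDet := by
  classical
  have hcols : Measurable fun z : Matrix m k ℂ × Matrix m n ℂ => Matrix.fromCols z.1 z.2 :=
    continuous_fromCols.measurable
  rw [← map_fromCols_prod_gaussianMatrix, Measure.map_map continuous_gramDet.measurable hcols]
  refine map_prod_eq_mconv (continuous_gramDet.measurable.comp hcols)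
    continuous_gramDet.measurable (hpos.mono fun A hA => ?_)
  obtain ⟨W, T, hW, rfl⟩ := exists_isometry_mul hA
  obtain ⟨V, hV, hWV⟩ := exists_isometry_complement hW hcard
  have hmul : Measurable fun B : Matrix m n ℂ => Vᴴ * B :=
    (continuous_const.matrix_mul continuous_id).measurable
  rw [← map_mul_left_gaussianMatrix (B := Vᴴ) (by rwa [Matrix.conjTranspose_conjTranspose]),
    Measure.map_map continuous_gramDet.measurable hmul,
    Measure.map_map (measurable_const_mul _) (continuous_gramDet.measurable.comp hmul)]
  simp only [Function.comp_def, gramDet_fromCols hW T hWV, gramDet_mul,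
    gramDet_eq_one_of_isometry hW, mul_one]

lemma map_gramDet_mul_prod_gaussianMatrix [Fintype p] {μ : Measure (Matrix m n ℂ)}
    (hpos : ∀ᵐ A ∂μ, gramDet A ≠ 0) :
    (μ.prod (gaussianMatrix p m)).map (fun z => gramDet (z.2 * z.1)) =
      μ.map gramDet ∗ₘ (gaussianMatrix p n).map gramDet := by
  refine map_prod_eq_mconv (continuous_gramDet.comp continuous_snd_mul_fst).measurable
    continuous_gramDet.measurable (hpos.mono fun A hA => ?_)
  obtain ⟨W, T, hW, rfl⟩ := exists_isometry_mul hA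
  have hmulW : Measurable fun G : Matrix p m ℂ => G * W :=
    (continuous_id.matrix_mul continuous_const).measurable
  rw [← map_mul_right_gaussianMatrix hW, Measure.map_map continuous_gramDet.measurable hmulW,
    Measure.map_map (measurable_const_mul _) (continuous_gramDet.measurable.comp hmulW)]
  simp only [Function.comp_def, ← Matrix.mul_assoc, gramDet_mul, gramDet_eq_one_of_isometry hW,
    mul_one]

/-- The mean of `log det (Gᴴ G)` for an `n × m` matrix `G` with independent standard complex
Gaussian entries, where `m ≤ n`. -/
noncomputable def wishartLogMean (n m : ℕ) : ℝ :=
  ∑ l ∈ Finset.range m, (harmonic (n - (l + 1)) - Real.eulerMascheroniConstant)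

lemma hasLogMean_gramDet_gaussianMatrix (n m : ℕ) (hmn : m ≤ n) :
    HasLogMean ((gaussianMatrix (Fin n) (Fin m)).map gramDet) (wishartLogMean n m) := by
  induction m with
  | zero =>
    have hone : (gramDet : Matrix (Fin n) (Fin 0) ℂ → ℝ) = fun _ => 1 :=
      funext fun A => by rw [gramDet, Matrix.det_isEmpty, Complex.one_re]
    rw [hone, Measure.map_const, measure_univ, one_smul, wishartLogMean, Finset.sum_range_zero]
    exact hasLogMean_dirac_one
  | succ m ih =>
    have hm := ih (by omega)
    obtain ⟨d, rfl⟩ := Nat.exists_eq_add_of_le hmn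
    have hpos : ∀ᵐ A ∂gaussianMatrix (Fin (m + 1 + d)) (Fin m), gramDet A ≠ 0 :=
      (ae_of_ae_map continuous_gramDet.aemeasurable hm.ae_pos).mono fun _ => ne_of_gt
    have hlast := map_gramDet_gaussianMatrix_unique (m := Fin (d + 1)) (n := Fin 1)
    rw [Fintype.card_fin, Nat.cast_add_one] at hlast
    have hlaw := map_gramDet_gaussianMatrix_sum (l := Fin (d + 1)) (n := Fin 1)
      (by simp only [Fintype.card_fin]; omega) hpos
    rw [map_gramDet_gaussianMatrix_congr finSumFinEquiv.symm, hlast] at hlaw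
    rw [hlaw, wishartLogMean, Finset.sum_range_succ, Nat.add_sub_cancel_left]
    have := Measure.isProbabilityMeasure_map (μ := gaussianMatrix (Fin (m + 1 + d)) (Fin m))
      continuous_gramDet.aemeasurable
    have := isProbabilityMeasure_gammaMeasure (d.cast_add_one_pos (α := ℝ)) one_pos
    exact hm.mconv (hasLogMean_gammaMeasure d)

end GaussianGramDet

section Frobenius

variable {l m n : Type*} [Fintype l] [Fintype m] [Fintype n]

/-- The squared Frobenius norm of a complex matrix. -/
noncomputable def frobeniusSq (A : Matrix m n ℂ) : ℝ :=
  ∑ i, ∑ j, ‖A i j‖ ^ 2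

lemma frobeniusSq_nonneg (A : Matrix m n ℂ) : 0 ≤ frobeniusSq A :=
  Finset.sum_nonneg fun _ _ => Finset.sum_nonneg fun _ _ => sq_nonneg _

lemma continuous_frobeniusSq : Continuous (frobeniusSq : Matrix m n ℂ → ℝ) :=
  continuous_finsetSum _ fun i _ => continuous_finsetSum _ fun j _ =>
    (continuous_id.matrix_elem i j).norm.pow 2

lemma frobeniusSq_mul_le (A : Matrix l m ℂ) (B : Matrix m n ℂ) :
    frobeniusSq (A * B) ≤ frobeniusSq A * frobeniusSq B := by
  have hB : frobeniusSq B = ∑ j, ∑ k, ‖B k j‖ ^ 2 := Finset.sum_comm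
  rw [hB, frobeniusSq, frobeniusSq, Finset.sum_mul_sum]
  refine Finset.sum_le_sum fun i _ => Finset.sum_le_sum fun j _ => ?_
  calc ‖(A * B) i j‖ ^ 2 ≤ (∑ k, ‖A i k‖ * ‖B k j‖) ^ 2 := by
        rw [Matrix.mul_apply]
        gcongr
        exact (norm_sum_le _ _).trans_eq (by simp only [norm_mul])
    _ ≤ _ := Finset.sum_mul_sq_le_sq_mul_sq _ _ _

lemma integrable_norm_sq_stdComplexGaussian :
    Integrable (fun z : ℂ => ‖z‖ ^ 2) stdComplexGaussian := by
  have h := integrable_rpow_gammaMeasure (a := 1) (r := 1) (t := 1) (by simp) (by simp) (by simp)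
  simp only [Real.rpow_one] at h
  rw [← expMeasure, ← map_norm_sq_stdComplexGaussian,
    integrable_map_measure (by fun_prop) (by fun_prop)] at h
  exact h

lemma integrable_frobeniusSq_gaussianMatrix : Integrable frobeniusSq (gaussianMatrix m n) := by
  rw [gaussianMatrix, integrable_map_measure continuous_frobeniusSq.aestronglyMeasurable
    continuous_of_curry.aemeasurable]
  exact integrable_finsetSum _ fun i _ => integrable_finsetSum _ fun j _ =>
    integrable_comp_eval (μ := fun _ : m × n => stdComplexGaussian) (i := (i, j))
      integrable_norm_sq_stdComplexGaussian

lemma integrable_frobeniusSq_map_mul_prod {μ : Measure (Matrix m n ℂ)} {ν : Measure (Matrix l m ℂ)}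
    (hμ : Integrable frobeniusSq μ) (hν : Integrable frobeniusSq ν) :
    Integrable frobeniusSq ((μ.prod ν).map fun z => z.2 * z.1) := by
  rw [integrable_map_measure continuous_frobeniusSq.aestronglyMeasurable
    continuous_snd_mul_fst.aemeasurable]
  refine (hμ.mul_prod hν).mono'
    (continuous_frobeniusSq.comp continuous_snd_mul_fst).aestronglyMeasurable
    (ae_of_all _ fun z => ?_)
  rw [Function.comp_apply, Real.norm_of_nonneg (frobeniusSq_nonneg _), mul_comm]
  exact frobeniusSq_mul_le _ _

end Frobenius

section ProductChannel

variable {Ω : Type*} {N : ℕ → ℕ} {Q : (k : ℕ) → Ω → Matrix (Fin (N (k + 1))) (Fin (N k)) ℂ}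

lemma productChannel_congr {Ω' : Type*}
    {Q' : (k : ℕ) → Ω' → Matrix (Fin (N (k + 1))) (Fin (N k)) ℂ} {ω : Ω} {ω' : Ω'} {k : ℕ}
    (h : ∀ j < k, Q j ω = Q' j ω') : productChannel N Q k ω = productChannel N Q' k ω' := by
  induction k with
  | zero => rfl
  | succ k ih =>
    rw [productChannel, productChannel, h k k.lt_succ_self,
      ih fun j hj => h j (hj.trans k.lt_succ_self)]

lemma aemeasurable_productChannel [MeasurableSpace Ω] {P : Measure Ω} {k : ℕ}
    (h : ∀ j < k, AEMeasurable (Q j) P) : AEMeasurable (productChannel N Q k) P := by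
  induction k with
  | zero => exact aemeasurable_const
  | succ k ih =>
    exact continuous_snd_mul_fst.measurable.comp_aemeasurable
      ((ih fun j hj => h j (hj.trans k.lt_succ_self)).prodMk (h k k.lt_succ_self))

end ProductChannel

section RayleighChain

variable {Ω : Type*} [MeasurableSpace Ω] {P : Measure Ω} {K : ℕ} {N : ℕ → ℕ}
  {Q : (k : ℕ) → Ω → Matrix (Fin (N (k + 1))) (Fin (N k)) ℂ} {k : ℕ}

lemma IsRayleighChain.hasLaw (hQ : IsRayleighChain P K N Q) (hk : k < K) :
    HasLaw (Q k) (gaussianMatrix (Fin (N (k + 1))) (Fin (N k))) P := by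
  have hinj : Function.Injective fun e : Fin (N (k + 1)) × Fin (N k) =>
      (⟨⟨k, hk⟩, e⟩ : Σ k : Fin K, Fin (N ((k : ℕ) + 1)) × Fin (N (k : ℕ))) :=
    fun a b h => by simpa using h
  have hentries := (hQ.indep.precomp hinj).hasLaw_pi
    fun e : Fin (N (k + 1)) × Fin (N k) => hQ.law k hk e.1 e.2
  have hof : HasLaw (fun x => Matrix.of (Function.curry x))
      (gaussianMatrix (Fin (N (k + 1))) (Fin (N k))) (gaussianVector _) :=
    ⟨continuous_of_curry.aemeasurable, rfl⟩
  exact hof.comp hentries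

lemma IsRayleighChain.indepFun_productChannel (hQ : IsRayleighChain P K N Q) (hk : k < K) :
    IndepFun (productChannel N Q k) (Q k) P := by
  let S : Finset (Σ k : Fin K, Fin (N ((k : ℕ) + 1)) × Fin (N (k : ℕ))) := {e | (e.1 : ℕ) < k}
  let T : Finset (Σ k : Fin K, Fin (N ((k : ℕ) + 1)) × Fin (N (k : ℕ))) := {e | (e.1 : ℕ) = k}
  have hST : Disjoint S T := Finset.disjoint_filter.2 fun _ _ h => h.ne
  let past (j : ℕ) (y : S → ℂ) : Matrix (Fin (N (j + 1))) (Fin (N j)) ℂ := Matrix.of fun a b =>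
    if h : j < k then y ⟨⟨⟨j, h.trans hk⟩, a, b⟩, by simpa [S] using h⟩ else 0
  let last (z : T → ℂ) : Matrix (Fin (N (k + 1))) (Fin (N k)) ℂ := Matrix.of fun a b =>
    z ⟨⟨⟨k, hk⟩, a, b⟩, by simp [T]⟩
  have hpast (j : ℕ) : Measurable (past j) :=
    Continuous.measurable <| continuous_matrix fun a b => by
      dsimp only [past, Matrix.of_apply]
      split_ifs <;> fun_prop
  have hlast : Measurable last :=
    Continuous.measurable (continuous_matrix fun a b => continuous_apply _)
  have hindep := hQ.indep.indepFun_finset₀ S T hST fun e =>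
    (hQ.law e.1 e.1.2 e.2.1 e.2.2).aemeasurable
  convert! hindep.comp₀ (φ := productChannel N past k) (ψ := last) ?_ ?_
    (aemeasurable_productChannel fun j _ => (hpast j).aemeasurable) hlast.aemeasurable using 1
  · funext ω
    refine productChannel_congr fun j hj => ?_
    ext a b
    simp [past, hj]
  all_goals exact aemeasurable_pi_lambda _ fun e =>
    (hQ.law e.1.1 e.1.1.2 e.1.2.1 e.1.2.2).aemeasurable

lemma IsRayleighChain.map_productChannel_succ [IsProbabilityMeasure P]
    (hQ : IsRayleighChain P K N Q) (hk : k < K) :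
    P.map (productChannel N Q (k + 1)) = ((P.map (productChannel N Q k)).prod
      (gaussianMatrix (Fin (N (k + 1))) (Fin (N k)))).map fun z => z.2 * z.1 := by
  have hH : AEMeasurable (productChannel N Q k) P :=
    aemeasurable_productChannel fun j hj => (hQ.hasLaw (hj.trans hk)).aemeasurable
  have hQk := hQ.hasLaw hk
  rw [← hQk.map_eq, ← (indepFun_iff_map_prod_eq_prod_map_map hH hQk.aemeasurable).1
    (hQ.indepFun_productChannel hk),
    AEMeasurable.map_map_of_aemeasurable continuous_snd_mul_fst.aemeasurable
      (hH.prodMk hQk.aemeasurable)]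
  rfl

lemma IsRayleighChain.hasLogMean_gramDet [IsProbabilityMeasure P] (hQ : IsRayleighChain P K N Q)
    (hN : ∀ k ≤ K, N 0 ≤ N k) (hk : k ≤ K) :
    HasLogMean ((P.map (productChannel N Q k)).map gramDet)
      (∑ j ∈ Finset.range k, wishartLogMean (N (j + 1)) (N 0)) := by
  induction k with
  | zero =>
    rw [AEMeasurable.map_map_of_aemeasurable continuous_gramDet.aemeasurable
      (aemeasurable_productChannel (by simp)), Finset.sum_range_zero]
    have hone : gramDet ∘ productChannel N Q 0 = fun _ => 1 :=
      funext fun _ => gramDet_eq_one_of_isometry (by simp [productChannel])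
    rw [hone, Measure.map_const, measure_univ, one_smul]
    exact hasLogMean_dirac_one
  | succ k ih =>
    have hH : AEMeasurable (productChannel N Q k) P :=
      aemeasurable_productChannel fun j hj => (hQ.hasLaw (hj.trans hk)).aemeasurable
    have : IsProbabilityMeasure (P.map (productChannel N Q k)) :=
      Measure.isProbabilityMeasure_map hH
    have := Measure.isProbabilityMeasure_map (μ := P.map (productChannel N Q k))
      continuous_gramDet.aemeasurable
    have hmean := ih (Nat.le_of_succ_le hk)
    have hpos := (ae_of_ae_map continuous_gramDet.aemeasurable hmean.ae_pos).mono
      fun _ => ne_of_gt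
    rw [hQ.map_productChannel_succ hk, Measure.map_map continuous_gramDet.measurable
      continuous_snd_mul_fst.measurable, Finset.sum_range_succ]
    have := Measure.isProbabilityMeasure_map
      (μ := gaussianMatrix (Fin (N (k + 1))) (Fin (N 0))) continuous_gramDet.aemeasurable
    convert! hmean.mconv (hasLogMean_gramDet_gaussianMatrix _ _ (hN (k + 1) hk)) using 1
    exact map_gramDet_mul_prod_gaussianMatrix hpos

lemma IsRayleighChain.integrable_frobeniusSq [IsProbabilityMeasure P]
    (hQ : IsRayleighChain P K N Q) (hk : k ≤ K) :
    Integrable frobeniusSq (P.map (productChannel N Q k)) := by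
  induction k with
  | zero =>
    rw [integrable_map_measure continuous_frobeniusSq.aestronglyMeasurable
      (aemeasurable_productChannel (by simp))]
    exact integrable_const (μ := P) (frobeniusSq (1 : Matrix (Fin (N 0)) (Fin (N 0)) ℂ))
  | succ k ih =>
    rw [hQ.map_productChannel_succ hk]
    exact integrable_frobeniusSq_map_mul_prod (ih (Nat.le_of_succ_le hk))
      integrable_frobeniusSq_gaussianMatrix

end RayleighChain

section LogOneAddMul

variable {q t : ℝ}

lemma log_one_add_mul_sub_log (hq : 0 < q) (ht : 0 < t) :
    Real.log (1 + q * t) - Real.log q = Real.log (q⁻¹ + t) := by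
  rw [← Real.log_div (by positivity) hq.ne']
  congr 1
  field_simp

lemma log_le_log_one_add_mul_sub_log (hq : 0 < q) (ht : 0 < t) :
    Real.log t ≤ Real.log (1 + q * t) - Real.log q := by
  rw [log_one_add_mul_sub_log hq ht]
  exact Real.log_le_log ht (le_add_of_nonneg_left (inv_pos.2 hq).le)

lemma log_one_add_mul_sub_log_le (hq : 1 ≤ q) (ht : 0 < t) :
    Real.log (1 + q * t) - Real.log q ≤ Real.log (1 + t) := by
  rw [log_one_add_mul_sub_log (by positivity) ht]
  exact Real.log_le_log (by positivity) (by gcongr; exact inv_le_one_of_one_le₀ hq)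

lemma tendsto_log_one_add_mul_sub_log (ht : 0 < t) :
    Tendsto (fun q => Real.log (1 + q * t) - Real.log q) atTop (𝓝 (Real.log t)) := by
  have h := (tendsto_inv_atTop_zero (𝕜 := ℝ)).add_const t
  rw [zero_add] at h
  exact (h.log ht.ne').congr' <| (eventually_gt_atTop 0).mono fun q hq =>
    (log_one_add_mul_sub_log hq ht).symm

-- The left side is the tangent line at `a` of the convex function `x ↦ log (1 + q * exp x)`,
-- evaluated at `x = log t`.
lemma tangent_le_log_one_add_mul (hq : 0 < q) (ht : 0 < t) (a : ℝ) :
    Real.log (1 + q * Real.exp a) +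
      q * Real.exp a / (1 + q * Real.exp a) * (Real.log t - a) ≤ Real.log (1 + q * t) := by
  have hE := Real.exp_pos a
  have hconcave := strictConcaveOn_log_Ioi.concaveOn.2 (Set.mem_Ioi.2 one_pos)
    (Set.mem_Ioi.2 (div_pos ht hE)) (show 0 ≤ 1 / (1 + q * Real.exp a) by positivity)
    (show 0 ≤ q * Real.exp a / (1 + q * Real.exp a) by positivity) (by field_simp)
  have hmean : 1 / (1 + q * Real.exp a) + q * Real.exp a / (1 + q * Real.exp a) *
      (t / Real.exp a) = (1 + q * t) / (1 + q * Real.exp a) := by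
    field_simp
  simp only [smul_eq_mul, Real.log_one, mul_zero, zero_add, mul_one] at hconcave
  rw [hmean, Real.log_div ht.ne' hE.ne', Real.log_div (by positivity) (by positivity),
    Real.log_exp] at hconcave
  linarith

end LogOneAddMul

section SingularValues

variable {m n : Type*} [Fintype m] [Fintype n] [DecidableEq n] {H : Matrix m n ℂ}

lemma det_one_add_smul_of_isHermitian {A : Matrix n n ℂ} (hA : A.IsHermitian)
    (q : ℝ) : (1 + (q : ℂ) • A).det = ((∏ i, (1 + q * hA.eigenvalues i) : ℝ) : ℂ) := by
  have hconj : 1 + (q : ℂ) • A = Unitary.conjStarAlgAut ℂ _ hA.eigenvectorUnitary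
      (1 + (q : ℂ) • Matrix.diagonal (RCLike.ofReal ∘ hA.eigenvalues)) := by
    rw [map_add, map_one, map_smul, ← hA.spectral_theorem]
  rw [hconj, Unitary.conjStarAlgAut_apply, Matrix.det_mul_right_comm,
    Unitary.mul_star_self_of_mem hA.eigenvectorUnitary.2, Matrix.one_mul, ← Matrix.diagonal_one,
    ← Matrix.diagonal_smul, Matrix.diagonal_add, Matrix.det_diagonal]
  push_cast
  rfl

/-- The squares of the singular values of `H`, i.e. the eigenvalues of `Hᴴ H`. -/
noncomputable def sqSingularValues (H : Matrix m n ℂ) : n → ℝ :=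
  (Matrix.isHermitian_conjTranspose_mul_self H).eigenvalues

lemma sqSingularValues_nonneg (H : Matrix m n ℂ) (i : n) :
    0 ≤ sqSingularValues H i :=
  Matrix.eigenvalues_conjTranspose_mul_self_nonneg H i

lemma gramDet_eq_prod_sqSingularValues (H : Matrix m n ℂ) :
    gramDet H = ∏ i, sqSingularValues H i := by
  rw [gramDet, (Matrix.isHermitian_conjTranspose_mul_self H).det_eq_prod_eigenvalues,
    ← RCLike.ofReal_prod]
  exact Complex.ofReal_re _

lemma frobeniusSq_eq_sum_sqSingularValues (H : Matrix m n ℂ) :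
    frobeniusSq H = ∑ i, sqSingularValues H i := by
  have htrace : (Hᴴ * H).trace = (frobeniusSq H : ℂ) := by
    simp only [Matrix.trace, Matrix.diag, Matrix.mul_apply, Matrix.conjTranspose_apply,
      frobeniusSq]
    rw [Finset.sum_comm]
    push_cast
    exact Finset.sum_congr rfl fun i _ => Finset.sum_congr rfl fun j _ =>
      Complex.conj_mul' (H i j)
  rw [(Matrix.isHermitian_conjTranspose_mul_self H).trace_eq_sum_eigenvalues,
    ← RCLike.ofReal_sum] at htrace
  exact (Complex.ofReal_injective htrace).symm

lemma sqSingularValues_pos (hH : 0 < gramDet H) (i : n) : 0 < sqSingularValues H i := by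
  rw [gramDet_eq_prod_sqSingularValues] at hH
  exact (sqSingularValues_nonneg H i).lt_of_ne'
    (Finset.prod_ne_zero_iff.1 hH.ne' i (Finset.mem_univ i))

lemma log_gramDet_eq_sum_log (hH : 0 < gramDet H) :
    Real.log (gramDet H) = ∑ i, Real.log (sqSingularValues H i) := by
  rw [gramDet_eq_prod_sqSingularValues, Real.log_prod fun i _ => (sqSingularValues_pos hH i).ne']

end SingularValues

section Capacity

variable {m n : ℕ} {H : Matrix (Fin m) (Fin n) ℂ} {q : ℝ}

lemma measurable_capacity (q : ℝ) :
    Measurable fun H : Matrix (Fin m) (Fin n) ℂ => capacity H q := by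
  have hgram : Continuous fun H : Matrix (Fin m) (Fin n) ℂ => Hᴴ * H :=
    continuous_id.matrix_conjTranspose.matrix_mul continuous_id
  exact Real.measurable_log.comp (Complex.continuous_re.comp
    (continuous_const.add (hgram.const_smul (q : ℂ))).matrix_det).measurable

lemma capacity_eq_sum_log (hq : 0 ≤ q) :
    capacity H q = ∑ i, Real.log (1 + q * sqSingularValues H i) := by
  rw [capacity, lnDet, det_one_add_smul_of_isHermitian
    (Matrix.isHermitian_conjTranspose_mul_self H), Complex.ofReal_re, Real.log_prod]
  · rfl
  · exact fun i _ => (add_pos_of_pos_of_nonneg one_pos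
      (mul_nonneg hq (sqSingularValues_nonneg H i))).ne'

lemma capacity_nonneg (hq : 0 ≤ q) : 0 ≤ capacity H q := by
  rw [capacity_eq_sum_log hq]
  exact Finset.sum_nonneg fun i _ => Real.log_nonneg
    (le_add_of_nonneg_right (mul_nonneg hq (sqSingularValues_nonneg H i)))

lemma capacity_le_mul_frobeniusSq (hq : 0 ≤ q) : capacity H q ≤ q * frobeniusSq H := by
  rw [capacity_eq_sum_log hq, frobeniusSq_eq_sum_sqSingularValues, Finset.mul_sum]
  refine Finset.sum_le_sum fun i _ => ?_
  have hi := mul_nonneg hq (sqSingularValues_nonneg H i)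
  linarith [Real.log_le_sub_one_of_pos (add_pos_of_pos_of_nonneg one_pos hi)]

lemma capacity_sub_mul_log (hq : 0 ≤ q) : capacity H q - n * Real.log q =
    ∑ i, (Real.log (1 + q * sqSingularValues H i) - Real.log q) := by
  rw [capacity_eq_sum_log hq, Finset.sum_sub_distrib, Finset.sum_const, Finset.card_univ,
    Fintype.card_fin, nsmul_eq_mul]

lemma log_gramDet_le_capacity_sub (hH : 0 < gramDet H) (hq : 0 < q) :
    Real.log (gramDet H) ≤ capacity H q - n * Real.log q := by
  rw [log_gramDet_eq_sum_log hH, capacity_sub_mul_log hq.le]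
  exact Finset.sum_le_sum fun i _ =>
    log_le_log_one_add_mul_sub_log hq (sqSingularValues_pos hH i)

lemma capacity_sub_le_capacity_one (hH : 0 < gramDet H) (hq : 1 ≤ q) :
    capacity H q - n * Real.log q ≤ capacity H 1 := by
  rw [capacity_sub_mul_log (by positivity), capacity_eq_sum_log zero_le_one]
  simp only [one_mul]
  exact Finset.sum_le_sum fun i _ => log_one_add_mul_sub_log_le hq (sqSingularValues_pos hH i)

lemma tendsto_capacity_sub (hH : 0 < gramDet H) :
    Tendsto (fun q => capacity H q - n * Real.log q) atTop (𝓝 (Real.log (gramDet H))) := by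
  rw [log_gramDet_eq_sum_log hH]
  refine (tendsto_finsetSum _ fun i _ =>
    tendsto_log_one_add_mul_sub_log (sqSingularValues_pos hH i)).congr' ?_
  exact (eventually_ge_atTop 0).mono fun q hq => (capacity_sub_mul_log hq).symm

lemma tangent_le_capacity (hH : 0 < gramDet H) (hq : 0 < q) (a : ℝ) :
    n * Real.log (1 + q * Real.exp a) +
      q * Real.exp a / (1 + q * Real.exp a) * (Real.log (gramDet H) - n * a) ≤ capacity H q := by
  rw [capacity_eq_sum_log hq.le, log_gramDet_eq_sum_log hH]
  refine le_of_eq_of_le ?_ (Finset.sum_le_sum fun i _ =>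
    tangent_le_log_one_add_mul hq (sqSingularValues_pos hH i) a)
  rw [Finset.sum_add_distrib, ← Finset.mul_sum, Finset.sum_sub_distrib]
  simp

end Capacity

section ErgodicCapacity

variable {Ω : Type*} [MeasurableSpace Ω] {P : Measure Ω} {m n : ℕ}
  {H : Ω → Matrix (Fin m) (Fin n) ℂ}

lemma integrable_capacity (hH : AEMeasurable H P) (hF : Integrable frobeniusSq (P.map H)) {q : ℝ}
    (hq : 0 ≤ q) : Integrable (fun ω => capacity (H ω) q) P := by
  refine ((hF.comp_aemeasurable hH).const_mul q).mono'
    ((measurable_capacity q).comp_aemeasurable hH).aestronglyMeasurable (ae_of_all _ fun ω => ?_)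
  rw [Real.norm_of_nonneg (capacity_nonneg hq)]
  exact capacity_le_mul_frobeniusSq hq

variable [IsProbabilityMeasure P]

lemma le_ergodicCapacity (hpos : ∀ᵐ ω ∂P, 0 < gramDet (H ω))
    (hlog : Integrable (fun ω => Real.log (gramDet (H ω))) P) {a : ℝ}
    (ha : ∫ ω, Real.log (gramDet (H ω)) ∂P = n * a) {q : ℝ} (hq : 0 < q)
    (hcap : Integrable (fun ω => capacity (H ω) q) P) :
    n * Real.log (1 + q * Real.exp a) ≤ ergodicCapacity P H q := by
  have hdev : Integrable (fun ω => q * Real.exp a / (1 + q * Real.exp a) *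
      (Real.log (gramDet (H ω)) - n * a)) P :=
    (hlog.sub (integrable_const _)).const_mul _
  calc n * Real.log (1 + q * Real.exp a)
      = ∫ ω, (n * Real.log (1 + q * Real.exp a) + q * Real.exp a / (1 + q * Real.exp a) *
          (Real.log (gramDet (H ω)) - n * a)) ∂P := by
        rw [integral_add (integrable_const _) hdev, integral_const, integral_const_mul,
          integral_sub hlog (integrable_const _), ha]
        simp
    _ ≤ ergodicCapacity P H q :=
        integral_mono_ae ((integrable_const _).add hdev) hcap
          (hpos.mono fun ω hω => tangent_le_capacity hω hq a)

lemma tendsto_ergodicCapacity_sub (hpos : ∀ᵐ ω ∂P, 0 < gramDet (H ω))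
    (hlog : Integrable (fun ω => Real.log (gramDet (H ω))) P)
    (hcap : ∀ q : ℝ, 0 < q → Integrable (fun ω => capacity (H ω) q) P) :
    Tendsto (fun q => ergodicCapacity P H q - n * Real.log q) atTop
      (𝓝 (∫ ω, Real.log (gramDet (H ω)) ∂P)) := by
  have hint (q : ℝ) (hq : 0 < q) :
      Integrable (fun ω => capacity (H ω) q - n * Real.log q) P :=
    (hcap q hq).sub (integrable_const _)
  have hlim : Tendsto (fun q => ∫ ω, (capacity (H ω) q - n * Real.log q) ∂P) atTop
      (𝓝 (∫ ω, Real.log (gramDet (H ω)) ∂P)) := by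
    refine tendsto_integral_filter_of_dominated_convergence
      (fun ω => |Real.log (gramDet (H ω))| + |capacity (H ω) 1|)
      ((eventually_gt_atTop 0).mono fun q hq => (hint q hq).aestronglyMeasurable) ?_
      (hlog.abs.add (hcap 1 one_pos).abs) (hpos.mono fun ω => tendsto_capacity_sub)
    filter_upwards [eventually_ge_atTop 1] with q hq
    filter_upwards [hpos] with ω hω
    exact (abs_le_max_abs_abs (log_gramDet_le_capacity_sub hω (one_pos.trans_le hq))
      (capacity_sub_le_capacity_one hω hq)).trans (max_le_add_of_nonneg (by simp) (by simp))
  refine hlim.congr' ((eventually_gt_atTop 0).mono fun q hq => ?_)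
  rw [integral_sub (hcap q hq) (integrable_const _), integral_const]
  simp [ergodicCapacity]

end ErgodicCapacity

section Constant

lemma sum_Icc_one_eq_sum_range (n : ℕ) (f : ℕ → ℝ) :
    ∑ i ∈ Finset.Icc 1 n, f i = ∑ i ∈ Finset.range n, f (i + 1) := by
  rw [Finset.range_eq_Ico, Finset.sum_Ico_add' f 0 n 1]
  rfl

lemma wishartLogMean_eq (n m : ℕ) : wishartLogMean n m =
    ∑ l ∈ Finset.Icc 1 m, ∑ r ∈ Finset.Icc 1 (n - l), 1 / (r : ℝ) -
      m * Real.eulerMascheroniConstant := by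
  simp [wishartLogMean, sum_Icc_one_eq_sum_range m, harmonic_eq_sum_Icc]

lemma sum_wishartLogMean (K : ℕ) (N : ℕ → ℕ) (hN : N 0 ≠ 0) :
    ∑ j ∈ Finset.range K, wishartLogMean (N (j + 1)) (N 0) =
      N 0 * (gConst K N - K * Real.eulerMascheroniConstant) := by
  rw [gConst, mul_sub, ← mul_assoc, mul_one_div_cancel (Nat.cast_ne_zero.2 hN), one_mul,
    sum_Icc_one_eq_sum_range]
  simp only [wishartLogMean_eq, Finset.sum_sub_distrib, Finset.sum_const, Finset.card_range,
    nsmul_eq_mul]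
  ring

lemma tendsto_capacityLowerBound_sub (K : ℕ) (N : ℕ → ℕ) :
    Tendsto (fun q => capacityLowerBound K N q - N 0 * Real.log q) atTop
      (𝓝 (N 0 * (gConst K N - K * Real.eulerMascheroniConstant))) := by
  have h := (tendsto_log_one_add_mul_sub_log
    (Real.exp_pos (gConst K N - K * Real.eulerMascheroniConstant))).const_mul (N 0 : ℝ)
  simpa only [capacityLowerBound, Real.log_exp, mul_sub] using h

end Constant

theorem corollary1 {Ω : Type*} [MeasurableSpace Ω] (P : Measure Ω) [IsProbabilityMeasure P]
    (K : ℕ) (hK : 1 ≤ K) (N : ℕ → ℕ) (hN0 : 1 ≤ N 0) (hN : ∀ k ≤ K, N 0 ≤ N k)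
    (Q : (k : ℕ) → Ω → Matrix (Fin (N (k + 1))) (Fin (N k)) ℂ)
    (hQ : IsRayleighChain P K N Q) :
    -- the expectations below are genuine: the integrands are defined a.s. and integrable
    (∀ q : ℝ, 0 < q → Integrable (fun ω => capacity (productChannel N Q K ω) q) P) ∧
    (∀ᵐ ω ∂P, 0 < ((productChannel N Q K ω)ᴴ * productChannel N Q K ω).det.re) ∧
    Integrable (fun ω => lnDet ((productChannel N Q K ω)ᴴ * productChannel N Q K ω)) P ∧
    -- the lower bound is a lower bound, and it is asymptotically tight
    (∀ q : ℝ, 0 < q →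
      capacityLowerBound K N q ≤ ergodicCapacity P (productChannel N Q K) q) ∧
    Tendsto (fun q : ℝ => ergodicCapacity P (productChannel N Q K) q - capacityLowerBound K N q)
      atTop (𝓝 0) ∧
    -- the high-SNR limit of the ergodic capacity and its value
    Tendsto (fun q : ℝ => ergodicCapacity P (productChannel N Q K) q - (N 0 : ℝ) * Real.log q)
      atTop (𝓝 (∫ ω, lnDet ((productChannel N Q K ω)ᴴ * productChannel N Q K ω) ∂P)) ∧
    (∫ ω, lnDet ((productChannel N Q K ω)ᴴ * productChannel N Q K ω) ∂P) =
      (N 0 : ℝ) * (gConst K N - (K : ℝ) * Real.eulerMascheroniConstant) := by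
  have hH : AEMeasurable (productChannel N Q K) P :=
    aemeasurable_productChannel fun k hk => (hQ.hasLaw hk).aemeasurable
  have hlogMean := hQ.hasLogMean_gramDet hN le_rfl
  rw [AEMeasurable.map_map_of_aemeasurable continuous_gramDet.aemeasurable hH,
    sum_wishartLogMean K N (Nat.one_le_iff_ne_zero.1 hN0)] at hlogMean
  obtain ⟨hpos, hlog, hmean⟩ :=
    (hasLogMean_map_iff (continuous_gramDet.measurable.comp_aemeasurable hH)).1 hlogMean
  have hcap (q : ℝ) (hq : 0 < q) : Integrable (fun ω => capacity (productChannel N Q K ω) q) P :=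
    integrable_capacity hH (hQ.integrable_frobeniusSq le_rfl) hq.le
  have hlim := tendsto_ergodicCapacity_sub hpos hlog hcap
  refine ⟨hcap, hpos, hlog, fun q hq => le_ergodicCapacity hpos hlog hmean hq (hcap q hq), ?_,
    hlim, hmean⟩
  have htight := hlim.sub (tendsto_capacityLowerBound_sub K N)
  simp only [Function.comp_apply] at hmean
  rw [hmean, sub_self] at htight
  exact htight.congr fun q => sub_sub_sub_cancel_right _ _ _
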